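/- Let $R=K[x_1,\ldots,x_n]$ be a polynomial ring over a field $K$, graded by giving the variables arbitrary positive integer degrees (for instance the standard grading), and let $F_1,\ldots,F_t$ be a regular sequence in $R$ consisting of homogeneous elements. Let $1\le c\le\min\{n,t\}$ and let $$I=\bigcap_{1\le i_1<\cdots<i_c\le t}(F_{i_1},\ldots,F_{i_c})$$ be the ideal of the star configuration of height $c$ on $F_1,\ldots,F_t$. Assume that, with respect to some positive grading of $R$ (a $K$-algebra grading $R=\bigoplus_{j\ge 0}A_j$ with $A_0=K$, possibly different from the one above), $I$ is generated by homogeneous elements of one and the same degree. Let $m\ge 1$. (1) For every finite generating family $g_1,\ldots,g_\mu$ of $I^m$ (in particular for every minimal one), the defining ideal of the Rees algebra $\mathcal R(I^m)=\bigoplus_{i\ge 0}I^{mi}t^i\subseteq R[t]$, that is, the kernel of the $R$-algebra map $R[T_1,\ldots,T_\mu]\to\mathcal R(I^m)$, $T_i\mapsto g_it$, is generated by polynomials that are homogeneous of degree at most $2$ in the variables $T_1,\ldots,T_\mu$. (2) The fiber-cone equations are quadratic binomials. That is, $I^m$ has a minimal generating family consisting of monomials $F_1^{a_1}\cdots F_t^{a_t}$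 in the $F_i$; and for every such minimal generating family $g_1,\ldots,g_\mu$, the kernel of the $K$-algebra map $K[T_1,\ldots,T_\mu]\to \mathcal R(I^m)\otimes_R K$, $T_i\mapsto g_it\otimes 1$, where $K=R/(x_1,\ldots,x_n)$, is generated by the binomials $T_iT_j-T_kT_l$ with $g_ig_j=g_kg_l$. -/

import Mathlib

open scoped TensorProduct

namespace StarRees

noncomputable section

/-- The ideal `I_{c,F}`: the intersection of the ideals generated by `c` members of the family `F`. -/
def starIdeal {R : Type*} [CommRing R] {t : ℕ} (c : ℕ) (F : Fin t → R) : Ideal R :=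
  ⨅ s : {s : Finset (Fin t) // s.card = c}, Ideal.span (F '' (s.1 : Set (Fin t)))

/-- The element `g t` of the Rees algebra of `J`, for `g ∈ J`. -/
def reesElement {R : Type*} [CommRing R] (J : Ideal R) (g : J) : reesAlgebra J :=
  ⟨Polynomial.monomial 1 (g : R), reesAlgebra.monomial_mem.mpr (by simp)⟩

/-- The map `R[T_i : i ∈ ι] → R(J)` sending `T_i` to `g_i t`. -/
def reesPresentation {R : Type*} [CommRing R] (J : Ideal R) {ι : Type*} (g : ι → J) :
    MvPolynomial ι R →ₐ[R] reesAlgebra J :=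
  MvPolynomial.aeval fun i => reesElement J (g i)

/-- The defining ideal of the Rees algebra of `J` with respect to the elements `g_i`. -/
def reesDefiningIdeal {R : Type*} [CommRing R] (J : Ideal R) {ι : Type*} (g : ι → J) :
    Ideal (MvPolynomial ι R) :=
  RingHom.ker (reesPresentation J g)

/-- The ideal `Q` of `A[T_i : i ∈ ι]` is generated by forms (in the `T_i`) of degree at most `N`. -/
def GeneratedInDegreeLE {A ι : Type*} [CommRing A] (Q : Ideal (MvPolynomial ι A)) (N : ℕ) : Prop :=
  Ideal.span {p : MvPolynomial ι A | p ∈ Q ∧ ∃ s ≤ N, p.IsHomogeneous s} = Q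

/-- The family `g` generates the ideal `J`. -/
def Generates {R : Type*} [CommRing R] (J : Ideal R) {ι : Type*} (g : ι → J) : Prop :=
  Ideal.span (Set.range fun i => (g i : R)) = J

/-- The family `g` generates the ideal `J`, and none of its members is redundant. -/
def MinimallyGenerates {R : Type*} [CommRing R] (J : Ideal R) {ι : Type*} (g : ι → J) : Prop :=
  Generates J g ∧ ∀ i, (g i : R) ∉ Ideal.span ((fun j => (g j : R)) '' {j | j ≠ i})

/-- `f` is a monomial in the `F_i`. -/
def IsMonomialIn {R : Type*} [CommRing R] {t : ℕ} (F : Fin t → R) (f : R) : Prop :=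
  ∃ a : Fin t → ℕ, f = ∏ i, F i ^ a i

/-- The ideal `(x_1, …, x_n)` of `K[x_1, …, x_n]`. -/
def irrelevantIdeal (K : Type*) [Field K] (n : ℕ) : Ideal (MvPolynomial (Fin n) K) :=
  Ideal.span (Set.range MvPolynomial.X)

/-- The fiber cone `R(J) ⊗_R K`, where `R = K[x_1, …, x_n]` and `K = R / (x_1, …, x_n)`. -/
abbrev FiberCone {K : Type*} [Field K] {n : ℕ} (J : Ideal (MvPolynomial (Fin n) K)) : Type _ :=
  reesAlgebra J ⊗[MvPolynomial (Fin n) K] (MvPolynomial (Fin n) K ⧸ irrelevantIdeal K n)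

/-- The map `K[T_i : i ∈ ι] → F(J)` sending `T_i` to the class of `g_i t`. -/
def fiberPresentation {K : Type*} [Field K] {n : ℕ} (J : Ideal (MvPolynomial (Fin n) K))
    {ι : Type*} (g : ι → J) : MvPolynomial ι K →ₐ[K] FiberCone J :=
  MvPolynomial.aeval fun i => (reesElement J (g i) ⊗ₜ[MvPolynomial (Fin n) K] 1 : FiberCone J)

/-- The defining ideal of the fiber cone of `J` with respect to the elements `g_i`. -/
def fiberDefiningIdeal {K : Type*} [Field K] {n : ℕ} (J : Ideal (MvPolynomial (Fin n) K))
    {ι : Type*} (g : ι → J) : Ideal (MvPolynomial ι K) :=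
  RingHom.ker (fiberPresentation J g)

/-- The binomials `T_i T_j - T_k T_l` with `g_i g_j = g_k g_l`. -/
def quadraticBinomials (K : Type*) [Field K] {R : Type*} [CommRing R] {J : Ideal R} {ι : Type*}
    (g : ι → J) : Set (MvPolynomial ι K) :=
  {p | ∃ i j k l : ι, (g i : R) * g j = (g k : R) * g l ∧
    p = MvPolynomial.X i * MvPolynomial.X j - MvPolynomial.X k * MvPolynomial.X l}

end

end StarRees

namespace StarRees

/-! Homogeneous elements of positive degree forming a regular sequence make `R` free over the
polynomial subring `K[F_1, …, F_t]`: lifts `v_b` of a `K`-basis of `R/(F)` give a `K`-basis `F^a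
v_b` of `R` (`exists_basis_fpow_mul`). Ideals generated by monomials in the `F_i` can therefore be
treated as ordinary monomial ideals, with membership read off from coordinates. In particular `I` is
generated by the products of `t - c + 1` distinct `F_i`, and `I^m` by the `F^a` with all `a_i ≤ m`
and `∑ a_i = m(t - c + 1)`.

These exponents are the bases of a discrete polymatroid of Veronese type: a unit may be moved from
any positive entry to any entry below `m`. The Rees presentation carries the basis `F^u v_b T^α`
into a basis of `R[t]`, so its kernel is spanned by differences of basis vectors with equal image.
The exchange property rewrites each difference through the relations `F_i T_k = F_j T_l` and `T_i
T_j = T_k T_l` (`fpow_mul_prod_eq`), which bounds the degrees by 2 for monomial generators.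
Substituting linear forms transfers the bound to any finite generating family. Passing to the fiber
cone kills the linear relations, because each `F_i` has zero constant term, and leaves the quadratic
binomials. -/

/-- The monomial with exponent vector `a` in the members of the family `F`. -/
def fpow {R : Type*} [CommRing R] {t : ℕ} (F : Fin t → R) (a : Fin t → ℕ) : R :=
  ∏ i, F i ^ a i

section fpow

variable {R : Type*} [CommRing R] {t : ℕ} (F : Fin t → R)

@[simp]
theorem fpow_zero : fpow F 0 = 1 := by simp [fpow]

theorem fpow_add (a b : Fin t → ℕ) : fpow F (a + b) = fpow F a * fpow F b := by
  simp [fpow, pow_add, Finset.prod_mul_distrib]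

@[simp]
theorem fpow_single (i : Fin t) : fpow F (Pi.single i 1) = F i := by
  unfold fpow
  rw [Finset.prod_eq_single i]
  · simp
  · intro j _ hj
    simp [Pi.single_eq_of_ne hj]
  · simp

end fpow

/-! ### Linear independence over a regular sequence -/

/-- If `w` is linearly independent modulo `Q + (r)` and `r` is a nonzerodivisor modulo `Q`, then
the products `r ^ k * w b` are linearly independent modulo `Q`. -/
theorem linearIndependent_mk_pow_mul {K R β : Type*} [Field K] [CommRing R] [Algebra K R]
    (Q : Ideal R) (r : R) (hr : ∀ x, r * x ∈ Q → x ∈ Q) (w : β → R)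
    (hw : LinearIndependent K fun b => Ideal.Quotient.mk (Q ⊔ Ideal.span {r}) (w b)) :
    LinearIndependent K fun x : ℕ × β => Ideal.Quotient.mk Q (r ^ x.1 * w x.2) := by
  classical
  have hr' : ∀ k x, r ^ k * x ∈ Q → x ∈ Q := by
    intro k
    induction k with
    | zero => simp
    | succ k ih =>
      intro x hx
      refine ih x (hr _ ?_)
      rwa [pow_succ', mul_assoc] at hx
  have mk_smul : ∀ (I : Ideal R) (c : K) (x : R),
      c • Ideal.Quotient.mk I x = Ideal.Quotient.mk I (c • x) := fun I c x => rfl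
  rw [linearIndependent_iff']
  intro s g hg
  -- Coefficients vanish in increasing order of the power of `r`: once those below `k` are gone, `r
  -- ^ k` can be cancelled modulo `Q`, and reduction modulo `r` leaves only the terms with exponent
  -- exactly `k`. The truncated `y.1 - k` affects only terms already known to be zero.
  have key : ∀ k, ∀ x ∈ s, x.1 = k → g x = 0 := by
    intro k
    induction k using Nat.strong_induction_on with
    | _ k ih =>
    simp only [mk_smul, ← map_sum, Ideal.Quotient.eq_zero_iff_mem] at hg
    have h1 : ∑ y ∈ s, g y • (r ^ y.1 * w y.2) =
        r ^ k * ∑ y ∈ s, g y • (r ^ (y.1 - k) * w y.2) := by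
      rw [Finset.mul_sum]
      refine Finset.sum_congr rfl fun y hy => ?_
      rcases lt_or_ge y.1 k with h | h
      · simp [ih _ h y hy rfl]
      · rw [mul_smul_comm, ← mul_assoc, ← pow_add, Nat.add_sub_cancel' h]
    rw [h1] at hg
    have h2 := hr' _ _ hg
    have h3 : ∑ y ∈ s with y.1 = k, g y • w y.2 ∈ Q ⊔ Ideal.span {r} := by
      have h4 : ∑ y ∈ s, g y • (r ^ (y.1 - k) * w y.2) =
          ∑ y ∈ s with y.1 = k, g y • w y.2 +
            ∑ y ∈ s with ¬ y.1 = k, g y • (r ^ (y.1 - k) * w y.2) := by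
        rw [← Finset.sum_filter_add_sum_filter_not s (fun y => y.1 = k)]
        congr 1
        refine Finset.sum_congr rfl fun y hy => ?_
        simp [(Finset.mem_filter.mp hy).2]
      have h5 : ∑ y ∈ s with ¬ y.1 = k, g y • (r ^ (y.1 - k) * w y.2) ∈
          Q ⊔ Ideal.span {r} := by
        refine Ideal.sum_mem _ fun y hy => ?_
        obtain ⟨hy, hne⟩ := Finset.mem_filter.mp hy
        rcases lt_or_ge y.1 k with h | h
        · simp [ih _ h y hy rfl]
        · obtain ⟨j, hj⟩ : ∃ j, y.1 - k = j + 1 := ⟨y.1 - k - 1, by omega⟩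
          rw [Algebra.smul_def]
          refine Ideal.mul_mem_left _ _ (Ideal.mem_sup_right ?_)
          rw [Ideal.mem_span_singleton, hj, pow_succ', mul_assoc]
          exact dvd_mul_right _ _
      rw [h4] at h2
      exact (Submodule.add_mem_iff_left _ h5).mp (Ideal.mem_sup_left h2)
    have h6 := linearIndependent_iff'.mp hw ((s.filter fun y => y.1 = k).image Prod.snd)
      (fun b => g (k, b)) (by
        rw [Finset.sum_image]
        · simp only [mk_smul, ← map_sum, Ideal.Quotient.eq_zero_iff_mem]
          convert h3 using 1
          refine Finset.sum_congr rfl fun y hy => ?_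
          rw [← (Finset.mem_filter.mp hy).2]
        · intro x hx y hy hxy
          have hx := (Finset.mem_filter.mp hx).2
          have hy := (Finset.mem_filter.mp hy).2
          exact Prod.ext (hx.trans hy.symm) hxy)
    intro x hx hxk
    have := h6 x.2 (Finset.mem_image.mpr ⟨x, Finset.mem_filter.mpr ⟨hx, hxk⟩, rfl⟩)
    rwa [← hxk] at this
  exact fun x hx => key _ x hx rfl

/-- If `F` is a weakly regular sequence modulo `Q` and `v` is linearly independent modulo `Q + (F)`,
then the products of monomials in `F` with members of `v` are linearly independent modulo `Q`. -/
theorem linearIndependent_mk_fpow_mul {K R β : Type*} [Field K] [CommRing R] [Algebra K R] {t : ℕ}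
    (F : Fin t → R) (Q : Ideal R)
    (hF : ∀ i x, F i * x ∈ Q ⊔ Ideal.span (F '' {j | j < i}) →
      x ∈ Q ⊔ Ideal.span (F '' {j | j < i}))
    (v : β → R)
    (hv : LinearIndependent K fun b => Ideal.Quotient.mk (Q ⊔ Ideal.span (Set.range F)) (v b)) :
    LinearIndependent K fun x : (Fin t → ℕ) × β => Ideal.Quotient.mk Q (fpow F x.1 * v x.2) := by
  induction t generalizing Q with
  | zero =>
    have h : Q ⊔ Ideal.span (Set.range F) = Q := by simp
    rw [h] at hv
    have := hv.comp (fun x : (Fin 0 → ℕ) × β => x.2)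
      (fun x y hxy => Prod.ext (Subsingleton.elim _ _) hxy)
    convert this using 2 with x
    simp [fpow]
  | succ t ih =>
    have himg : ∀ i : Fin t, Q ⊔ Ideal.span {F 0} ⊔ Ideal.span (Fin.tail F '' {j | j < i}) =
        Q ⊔ Ideal.span (F '' {j | j < i.succ}) := by
      intro i
      rw [sup_assoc, ← Ideal.span_union]
      congr 2
      ext y
      constructor
      · rintro (rfl | ⟨j, hj, rfl⟩)
        · exact ⟨0, Fin.succ_pos i, rfl⟩
        · exact ⟨j.succ, Fin.succ_lt_succ_iff.mpr hj, rfl⟩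
      · rintro ⟨j, hj, rfl⟩
        cases j using Fin.cases with
        | zero => exact Or.inl rfl
        | succ j => exact Or.inr ⟨j, Fin.succ_lt_succ_iff.mp hj, rfl⟩
    have hrange : Q ⊔ Ideal.span {F 0} ⊔ Ideal.span (Set.range (Fin.tail F)) =
        Q ⊔ Ideal.span (Set.range F) := by
      rw [sup_assoc, ← Ideal.span_union]
      congr 2
      ext y
      constructor
      · rintro (rfl | ⟨j, rfl⟩)
        · exact ⟨0, rfl⟩
        · exact ⟨j.succ, rfl⟩
      · rintro ⟨j, rfl⟩
        cases j using Fin.cases with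
        | zero => exact Or.inl rfl
        | succ j => exact Or.inr ⟨j, rfl⟩
    -- The first member is absorbed into the base ideal, so the remaining sequence is handled modulo
    -- `Q + (F 0)`; powers of `F 0` are restored afterwards.
    have h1 := ih (Fin.tail F) (Q ⊔ Ideal.span {F 0}) (fun i x => by
      rw [himg]; exact hF i.succ x) (by rwa [hrange])
    have h2 := linearIndependent_mk_pow_mul Q (F 0) (fun x => by simpa using hF 0 x) _ h1
    have h3 := h2.comp
      (fun x : (Fin (t + 1) → ℕ) × β => (x.1 0, ((Fin.tail x.1 : Fin t → ℕ), x.2))) (by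
        rintro ⟨a, b⟩ ⟨a', b'⟩ h
        simp only [Prod.mk.injEq] at h
        obtain ⟨h0, h1, h2⟩ := h
        refine Prod.ext ?_ h2
        rw [← Fin.cons_self_tail a, ← Fin.cons_self_tail a', h0, h1])
    convert h3 using 2 with x
    simp [fpow, Fin.prod_univ_succ, Fin.tail, mul_assoc]

/-! ### The basis given by a homogeneous regular sequence -/

section Grading

open MvPolynomial

variable {K : Type*} [Field K] {n t : ℕ} {w : Fin n → ℕ}

theorem weightedHomogeneousComponent_mul_left {f : MvPolynomial (Fin n) K} {d : ℕ}
    (hf : f.IsWeightedHomogeneous w d) (δ : ℕ) (p : MvPolynomial (Fin n) K) :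
    weightedHomogeneousComponent w δ (f * p) =
      if d ≤ δ then f * weightedHomogeneousComponent w (δ - d) p else 0 := by
  classical
  induction p using MvPolynomial.induction_on' with
  | monomial u a =>
    have hm : (monomial u a).IsWeightedHomogeneous w (Finsupp.weight w u) :=
      isWeightedHomogeneous_monomial w u a rfl
    rw [weightedHomogeneousComponent_of_mem (hf.mul hm), weightedHomogeneousComponent_of_mem hm]
    split_ifs <;> first | rfl | omega | simp
  | add p q hp hq =>
    rw [mul_add, map_add, hp, hq, map_add]
    split_ifs <;> ring

theorem mul_mem_span_of_isWeaklyRegular {R : Type*} [CommRing R] {F : Fin t → R}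
    (hreg : RingTheory.Sequence.IsWeaklyRegular R (List.ofFn F)) (i : Fin t) (x : R)
    (hx : F i * x ∈ Ideal.span (F '' {j | j < i})) : x ∈ Ideal.span (F '' {j | j < i}) := by
  have h := hreg.regular_mod_prev i (by simp)
  have hI : (Ideal.ofList ((List.ofFn F).take i) • ⊤ : Submodule R R) =
      Ideal.span (F '' {j | j < i}) := by
    rw [smul_eq_mul, Ideal.mul_top, Ideal.ofList]
    congr 1
    ext y
    simp only [List.mem_take_iff_getElem, Set.mem_ofPred_eq, Set.mem_image, List.getElem_ofFn]
    constructor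
    · rintro ⟨j, hj, rfl⟩
      simp only [List.length_ofFn, lt_inf_iff] at hj
      exact ⟨⟨j, hj.2⟩, Fin.lt_def.mpr hj.1, rfl⟩
    · rintro ⟨j, hj, rfl⟩
      exact ⟨j, by simpa using hj, rfl⟩
  rw [hI] at h
  simp only [List.getElem_ofFn] at h
  rw [← Submodule.Quotient.mk_eq_zero]
  refine h ?_
  simp only [smul_zero]
  rw [← Submodule.Quotient.mk_smul, Submodule.Quotient.mk_eq_zero]
  exact hx

/-- With positive weights an element of degree 0 is a constant, hence zero or a unit. A unit
contradicts properness of `(F)`, and `F i = 0` would put 1 in the ideal of the earlier members. -/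
theorem degree_pos_of_isRegular (hw : ∀ i, 0 < w i) (F : Fin t → MvPolynomial (Fin n) K)
    (d : Fin t → ℕ) (hF : ∀ i, (F i).IsWeightedHomogeneous w (d i))
    (hreg : RingTheory.Sequence.IsRegular (MvPolynomial (Fin n) K) (List.ofFn F)) (i : Fin t) :
    0 < d i := by
  have htop : Ideal.span (Set.range F) ≠ ⊤ := by
    intro h
    refine hreg.top_ne_smul ?_
    rw [smul_eq_mul, Ideal.mul_top, ← h, Ideal.ofList]
    congr 1
    ext y
    simp [List.mem_ofFn]
  have hwr := mul_mem_span_of_isWeaklyRegular hreg.toIsWeaklyRegular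
  have h0 : ∀ i, F i ≠ 0 := by
    intro i hi
    have h1 := hwr i 1 (by simp [hi])
    exact htop (Ideal.eq_top_of_isUnit_mem _
      (Ideal.span_mono (Set.image_subset_range _ _) h1) isUnit_one)
  rw [Nat.pos_iff_ne_zero]
  intro hd
  have h := hF i
  rw [hd] at h
  have hC : F i = C (coeff 0 (F i)) := by
    ext u
    by_cases hu : u = 0
    · simp [hu]
    · rw [coeff_C, if_neg (Ne.symm hu)]
      have : Finsupp.NonTorsionWeight ℕ w :=
        Finsupp.nonTorsionWeight_of ℕ w fun j => (hw j).ne'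
      exact h.coeff_eq_zero u fun hz => hu ((Finsupp.weight_eq_zero_iff_eq_zero w).mp hz)
  refine htop (Ideal.eq_top_of_isUnit_mem _ (Ideal.subset_span ⟨i, rfl⟩) ?_)
  rw [hC]
  refine (isUnit_iff_ne_zero.mpr fun hz => h0 i ?_).map C
  rw [hC, hz, map_zero]

/-- A spanning family of weighted homogeneous elements modulo `(F)` gives, together with the
monomials in `F`, a spanning family of the polynomial ring. -/
theorem span_fpow_mul_eq_top {β : Type*} {F : Fin t → MvPolynomial (Fin n) K}
    {d : Fin t → ℕ} (hF : ∀ i, (F i).IsWeightedHomogeneous w (d i)) (hd : ∀ i, 0 < d i)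
    (v : β → MvPolynomial (Fin n) K) (hv : ∀ b, ∃ k, (v b).IsWeightedHomogeneous w k)
    (hspan : ∀ p, ∃ q ∈ Submodule.span K (Set.range v), p - q ∈ Ideal.span (Set.range F)) :
    Submodule.span K (Set.range fun x : (Fin t → ℕ) × β => fpow F x.1 * v x.2) = ⊤ := by
  classical
  set T := Submodule.span K (Set.range fun x : (Fin t → ℕ) × β => fpow F x.1 * v x.2) with hT
  have hmul : ∀ i, ∀ p ∈ T, F i * p ∈ T := by
    intro i p hp
    have : T ≤ T.comap (LinearMap.mulLeft K (F i)) := by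
      conv_lhs => rw [hT]
      rw [Submodule.span_le]
      rintro _ ⟨⟨a, b⟩, rfl⟩
      refine Submodule.subset_span ⟨(Pi.single i 1 + a, b), ?_⟩
      simp [fpow_add, mul_assoc]
    exact this hp
  -- A graded Nakayama argument: modulo the span of `v`, an element is a combination of the `F i`,
  -- whose coefficients contribute only through their components of degree `δ - d i < δ`.
  have hcomp : ∀ δ, ∀ p, weightedHomogeneousComponent w δ p ∈ T := by
    intro δ
    induction δ using Nat.strong_induction_on with
    | _ δ ih =>
    intro p
    obtain ⟨q, hq, hpq⟩ := hspan p
    obtain ⟨c, hc⟩ := (Ideal.mem_span_range_iff_exists_fun).mp hpq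
    rw [← sub_add_cancel p q, ← hc, map_add, map_sum]
    refine add_mem (sum_mem fun i _ => ?_) ?_
    · rw [mul_comm, weightedHomogeneousComponent_mul_left (hF i)]
      split_ifs with h
      · exact hmul i _ (ih _ (by have := hd i; omega) _)
      · exact zero_mem _
    · have : Submodule.span K (Set.range v) ≤ T.comap (weightedHomogeneousComponent w δ) := by
        rw [Submodule.span_le]
        rintro _ ⟨b, rfl⟩
        obtain ⟨k, hk⟩ := hv b
        change weightedHomogeneousComponent w δ (v b) ∈ T
        rw [weightedHomogeneousComponent_of_mem hk]
        split_ifs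
        · exact Submodule.subset_span ⟨(0, b), by simp⟩
        · exact zero_mem _
      exact this hq
  rw [eq_top_iff]
  intro p _
  rw [← sum_weightedHomogeneousComponent w p]
  exact finsum_induction (· ∈ T) (zero_mem _) (fun _ _ => add_mem) fun δ => hcomp δ p

/-- A homogeneous weakly regular sequence `F` of positive degrees in a polynomial ring admits a family `v`
such that the products of monomials in `F` with members of `v` form a basis. -/
theorem exists_basis_fpow_mul (F : Fin t → MvPolynomial (Fin n) K)
    (d : Fin t → ℕ) (hF : ∀ i, (F i).IsWeightedHomogeneous w (d i)) (hd : ∀ i, 0 < d i)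
    (hreg : RingTheory.Sequence.IsWeaklyRegular (MvPolynomial (Fin n) K) (List.ofFn F)) :
    ∃ (β : Type) (v : β → MvPolynomial (Fin n) K)
      (B : Module.Basis ((Fin t → ℕ) × β) K (MvPolynomial (Fin n) K)),
      ∀ x, B x = fpow F x.1 * v x.2 := by
  have hwr := mul_mem_span_of_isWeaklyRegular hreg
  set Q := Ideal.span (Set.range F) with hQ
  -- The basis of the quotient is selected among classes of monomials, so that its lifts are
  -- automatically homogeneous.
  obtain ⟨κ, a, -, hspan, hli⟩ := exists_linearIndependent' K
    (fun u : Fin n →₀ ℕ => Ideal.Quotient.mk Q (monomial u (1 : K)))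
  let v : κ → MvPolynomial (Fin n) K := fun b => monomial (a b) 1
  have hmap : ∀ {ι : Type} (f : ι → MvPolynomial (Fin n) K),
      Submodule.span K (Set.range fun i => Ideal.Quotient.mk Q (f i)) =
        (Submodule.span K (Set.range f)).map (Ideal.Quotient.mkₐ K Q).toLinearMap := by
    intro ι f
    rw [Submodule.map_span, ← Set.range_comp]
    rfl
  have hmono : Submodule.span K (Set.range fun u : Fin n →₀ ℕ => monomial u (1 : K)) = ⊤ := by
    rw [← (basisMonomials (Fin n) K).span_eq, coe_basisMonomials]
  have htop' : (Submodule.span K (Set.range v)).map (Ideal.Quotient.mkₐ K Q).toLinearMap =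
      (⊤ : Submodule K (MvPolynomial (Fin n) K)).map (Ideal.Quotient.mkₐ K Q).toLinearMap := by
    rw [← hmono, ← hmap, ← hmap, ← hspan]
    rfl
  have hspan' := span_fpow_mul_eq_top hF hd v
    (fun b => ⟨_, isWeightedHomogeneous_monomial w _ _ rfl⟩) (by
      intro p
      have hp : (Ideal.Quotient.mkₐ K Q).toLinearMap p ∈
          (⊤ : Submodule K (MvPolynomial (Fin n) K)).map (Ideal.Quotient.mkₐ K Q).toLinearMap :=
        Submodule.mem_map_of_mem trivial
      rw [← htop'] at hp
      obtain ⟨q, hq, hqp⟩ := hp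
      exact ⟨q, hq, Ideal.Quotient.eq.mp hqp.symm⟩)
  have hind := linearIndependent_mk_fpow_mul (K := K) F ⊥ (by simpa using hwr) v (by
    rw [bot_sup_eq]
    exact hli)
  have hind' : LinearIndependent K fun x : (Fin t → ℕ) × κ => fpow F x.1 * v x.2 :=
    LinearIndependent.of_comp (Ideal.Quotient.mkₐ K ⊥).toLinearMap hind
  exact ⟨κ, v, Module.Basis.mk hind' hspan'.ge, fun x => by simp⟩

end Grading

/-! ### Ideals generated by monomials in `F` -/

section MonomialIdeals

variable {K R β : Type*} [Field K] [CommRing R] [Algebra K R] {t : ℕ} {F : Fin t → R} {v : β → R}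
  (B : Module.Basis ((Fin t → ℕ) × β) K R)

/-- Multiplication by `F^u` shifts the basis index `(a, b)` to `(a + u, b)`. -/
theorem repr_mul_fpow (hB : ∀ x, B x = fpow F x.1 * v x.2) (x : R) (u : Fin t → ℕ)
    (y : (Fin t → ℕ) × β) (hy : B.repr (x * fpow F u) y ≠ 0) : u ≤ y.1 := by
  classical
  have h : x * fpow F u =
      (B.repr x).sum fun z c => c • B (z.1 + u, z.2) := by
    conv_lhs => rw [← B.linearCombination_repr x, Finsupp.linearCombination_apply, Finsupp.sum_mul]
    refine Finsupp.sum_congr fun z _ => ?_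
    rw [hB, hB, fpow_add, smul_mul_assoc, mul_right_comm]
  by_contra hle
  refine hy ?_
  rw [h, Finsupp.sum, map_sum, Finsupp.finsetSum_apply]
  refine Finset.sum_eq_zero fun z _ => ?_
  rw [map_smul, B.repr_self, Finsupp.smul_apply, Finsupp.single_eq_of_ne, smul_zero]
  rintro rfl
  exact hle fun i => Nat.le_add_left _ _

/-- Membership in an ideal generated by monomials in `F` is read off from the coordinates. -/
theorem mem_span_fpow_iff (hB : ∀ x, B x = fpow F x.1 * v x.2) (U : Set (Fin t → ℕ)) (x : R) :
    x ∈ Ideal.span (fpow F '' U) ↔ ∀ y, B.repr x y ≠ 0 → ∃ u ∈ U, u ≤ y.1 := by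
  classical
  constructor
  · intro hx y hy
    obtain ⟨c, hc, rfl⟩ := Submodule.mem_span_set.mp hx
    rw [Finsupp.sum, map_sum, Finsupp.finsetSum_apply] at hy
    obtain ⟨f, hf, hne⟩ := Finset.exists_ne_zero_of_sum_ne_zero hy
    obtain ⟨u, hu, rfl⟩ := hc hf
    exact ⟨u, hu, repr_mul_fpow B hB _ u y hne⟩
  · intro h
    rw [← B.linearCombination_repr x, Finsupp.linearCombination_apply]
    refine Ideal.sum_mem _ fun y hy => ?_
    obtain ⟨u, hu, hle⟩ := h y (Finsupp.mem_support_iff.mp hy)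
    dsimp only
    rw [hB, ← add_tsub_cancel_of_le hle, fpow_add, Algebra.smul_def]
    refine Ideal.mul_mem_left _ _ (Ideal.mul_mem_right _ _ (Ideal.mul_mem_right _ _ ?_))
    exact Ideal.subset_span ⟨u, hu, rfl⟩

theorem fpow_mem_span_fpow_iff [Nonempty β] (hB : ∀ x, B x = fpow F x.1 * v x.2)
    (U : Set (Fin t → ℕ)) (a : Fin t → ℕ) :
    fpow F a ∈ Ideal.span (fpow F '' U) ↔ ∃ u ∈ U, u ≤ a := by
  constructor
  · intro h
    obtain ⟨b⟩ := ‹Nonempty β›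
    -- `F^a` itself need not be a basis vector, so the test is made on its multiple `F^a v_b`.
    have h1 : B (a, b) ∈ Ideal.span (fpow F '' U) := by
      rw [hB]
      exact Ideal.mul_mem_right _ _ h
    exact (mem_span_fpow_iff B hB U _).mp h1 (a, b) (by simp)
  · rintro ⟨u, hu, hle⟩
    rw [← add_tsub_cancel_of_le hle, fpow_add]
    exact Ideal.mul_mem_right _ _ (Ideal.subset_span ⟨u, hu, rfl⟩)

/-- The exponent vectors of total degree `D` with all entries at most `m`. -/
def boundedExponents (t m D : ℕ) : Set (Fin t → ℕ) :=
  {a | (∀ i, a i ≤ m) ∧ ∑ i, a i = D}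

/-- The star configuration ideal is generated by the squarefree monomials of degree `t - c + 1`. -/
theorem starIdeal_eq_span (hB : ∀ x, B x = fpow F x.1 * v x.2) {c : ℕ} (hct : c ≤ t) :
    starIdeal c F = Ideal.span (fpow F '' boundedExponents t 1 (t - c + 1)) := by
  classical
  have hprime : ∀ s : Finset (Fin t), Ideal.span (F '' (s : Set (Fin t))) =
      Ideal.span (fpow F '' ((fun i => Pi.single i 1) '' (s : Set (Fin t)))) := by
    intro s
    simp [Set.image_image]
  ext x
  rw [starIdeal, Ideal.mem_iInf, mem_span_fpow_iff B hB]
  simp only [hprime, mem_span_fpow_iff B hB]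
  constructor
  · intro h y hy
    set S := Finset.univ.filter fun i => y.1 i ≠ 0 with hS
    -- A smaller support would miss some `c`-element set `s`, contradicting membership in the ideal
    -- generated by the `F i` with `i ∈ s`.
    have hcard : t - c + 1 ≤ S.card := by
      by_contra hlt
      have h1 : c ≤ Sᶜ.card := by
        rw [Finset.card_compl, Fintype.card_fin]
        omega
      obtain ⟨s, hs, hsc⟩ := Finset.exists_subset_card_eq h1
      obtain ⟨_, ⟨i, hi, rfl⟩, hle⟩ := h ⟨s, hsc⟩ y hy
      have h2 := hs hi
      have h3 := hle i
      simp only [Pi.single_eq_same] at h3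
      simp only [hS, Finset.mem_compl, Finset.mem_filter, Finset.mem_univ, true_and] at h2
      omega
    obtain ⟨A, hA, hAc⟩ := Finset.exists_subset_card_eq hcard
    refine ⟨fun i => if i ∈ A then 1 else 0, ⟨fun i => by dsimp only; split_ifs <;> simp, ?_⟩, fun i => ?_⟩
    · simp [hAc]
    · dsimp only
      split_ifs with hi
      · have := (Finset.mem_filter.mp (hA hi)).2
        omega
      · exact Nat.zero_le _
  · rintro h ⟨s, hsc⟩ y hy
    obtain ⟨u, ⟨hu1, hu2⟩, hle⟩ := h y hy
    -- A 0-1 vector vanishing on `s` has total at most `t - c`.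
    obtain ⟨i, his, hiu⟩ : ∃ i ∈ s, u i ≠ 0 := by
      by_contra! hno
      have h1 : ∑ i, u i ≤ ∑ i, if i ∈ sᶜ then 1 else 0 := by
        refine Finset.sum_le_sum fun i _ => ?_
        split_ifs with hi
        · exact hu1 i
        · exact (hno i (by simpa using hi)).le
      rw [hu2, Finset.sum_ite_mem, Finset.univ_inter, Finset.sum_const, Finset.card_compl, hsc,
        Fintype.card_fin, smul_eq_mul, mul_one] at h1
      omega
    refine ⟨_, ⟨i, his, rfl⟩, fun j => ?_⟩
    by_cases hj : j = i
    · subst hj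
      simpa using (Nat.one_le_iff_ne_zero.mpr hiu).trans (hle j)
    · simp [Pi.single_eq_of_ne hj]

end MonomialIdeals

/-! ### Generators of the powers -/

/-- The vector `e` is the indicator of a `k`-element set lying between the set of entries equal to
`m + 1` and the support of `a`. Such a set exists because the total `(m + 1) * k` forces the former
to have at most `k` elements and the latter at least `k`. -/
theorem exists_le_sub_mem_boundedExponents {t m k : ℕ} {a : Fin t → ℕ}
    (ha : a ∈ boundedExponents t (m + 1) ((m + 1) * k)) :
    ∃ e ∈ boundedExponents t 1 k, ∃ a' ∈ boundedExponents t m (m * k), e + a' = a := by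
  classical
  obtain ⟨ha1, ha2⟩ := ha
  set S := Finset.univ.filter fun i => a i = m + 1 with hS
  set S' := Finset.univ.filter fun i => a i ≠ 0 with hS'
  have hSS' : S ⊆ S' := by
    intro i hi
    simp only [hS, hS', Finset.mem_filter, Finset.mem_univ, true_and] at hi ⊢
    omega
  have h1 : S.card ≤ k := by
    have h : ∑ i, (if i ∈ S then m + 1 else 0) ≤ ∑ i, a i := by
      refine Finset.sum_le_sum fun i _ => ?_
      split_ifs with hi
      · exact (Finset.mem_filter.mp hi).2.ge
      · exact Nat.zero_le _
    rw [ha2, Finset.sum_ite_mem, Finset.univ_inter, Finset.sum_const, smul_eq_mul, mul_comm] at h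
    exact Nat.le_of_mul_le_mul_left h (Nat.succ_pos m)
  have h2 : k ≤ S'.card := by
    have h : ∑ i, a i ≤ ∑ i, (if i ∈ S' then m + 1 else 0) := by
      refine Finset.sum_le_sum fun i _ => ?_
      split_ifs with hi
      · exact ha1 i
      · simp only [hS', Finset.mem_filter, Finset.mem_univ, true_and, not_not] at hi
        exact hi.le
    rw [ha2, Finset.sum_ite_mem, Finset.univ_inter, Finset.sum_const, smul_eq_mul,
      mul_comm S'.card] at h
    exact Nat.le_of_mul_le_mul_left h (Nat.succ_pos m)
  obtain ⟨A, hSA, hAS', hA⟩ := Finset.exists_subsuperset_card_eq hSS' h1 h2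
  have hle : (fun i => if i ∈ A then 1 else 0) ≤ a := by
    intro i
    dsimp only
    split_ifs with hi
    · have := (Finset.mem_filter.mp (hAS' hi)).2
      omega
    · exact Nat.zero_le _
  have hsum : ∑ i, (if i ∈ A then 1 else 0) = k := by simp [hA]
  refine ⟨fun i => if i ∈ A then 1 else 0, ⟨fun i => by dsimp only; split_ifs <;> simp, hsum⟩,
    a - fun i => if i ∈ A then 1 else 0, ⟨fun i => ?_, ?_⟩, add_tsub_cancel_of_le hle⟩
  · have hi := ha1 i
    simp only [Pi.sub_apply]
    split_ifs with h
    · omega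
    · have : a i ≠ m + 1 := fun h' => h (hSA (by simp [hS, h']))
      omega
  · have h3 : ∑ i, (if i ∈ A then 1 else 0) +
        ∑ i, (a i - if i ∈ A then 1 else 0) = ∑ i, a i := by
      rw [← Finset.sum_add_distrib]
      exact Finset.sum_congr rfl fun i _ => add_tsub_cancel_of_le (hle i)
    rw [hsum, ha2, add_mul, one_mul, add_comm] at h3
    exact Nat.add_right_cancel h3

theorem span_fpow_boundedExponents_pow {R : Type*} [CommRing R] {t : ℕ} (F : Fin t → R)
    (m k : ℕ) : Ideal.span (fpow F '' boundedExponents t 1 k) ^ m =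
      Ideal.span (fpow F '' boundedExponents t m (m * k)) := by
  induction m with
  | zero =>
    rw [pow_zero, Ideal.one_eq_top, eq_comm, Ideal.eq_top_iff_one]
    exact Ideal.subset_span ⟨0, ⟨by simp, by simp⟩, by simp⟩
  | succ m ih =>
    rw [pow_succ', ih, Ideal.span_mul_span']
    congr 1
    ext x
    constructor
    · rintro ⟨_, ⟨e, ⟨he1, he2⟩, rfl⟩, _, ⟨a, ⟨ha1, ha2⟩, rfl⟩, rfl⟩
      refine ⟨e + a, ⟨fun i => ?_, ?_⟩, fpow_add F e a⟩
      · have := he1 i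
        have := ha1 i
        simp only [Pi.add_apply]
        omega
      · simp only [Pi.add_apply, Finset.sum_add_distrib, he2, ha2]
        ring
    · rintro ⟨a, ha, rfl⟩
      obtain ⟨e, he, a', ha', rfl⟩ := exists_le_sub_mem_boundedExponents ha
      exact ⟨_, ⟨e, he, rfl⟩, _, ⟨a', ha', rfl⟩, (fpow_add F e a').symm⟩

theorem starIdeal_pow_eq_span {K R β : Type*} [Field K] [CommRing R] [Algebra K R] {t : ℕ}
    {F : Fin t → R} {v : β → R} (B : Module.Basis ((Fin t → ℕ) × β) K R)
    (hB : ∀ x, B x = fpow F x.1 * v x.2) {c : ℕ} (hct : c ≤ t) (m : ℕ) :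
    starIdeal c F ^ m =
      Ideal.span (fpow F '' boundedExponents t m (m * (t - c + 1))) := by
  rw [starIdeal_eq_span B hB hct, span_fpow_boundedExponents_pow]

theorem finite_boundedExponents (t m D : ℕ) : (boundedExponents t m D).Finite :=
  (Set.finite_Iic (fun _ : Fin t => m)).subset fun _ ha i => ha.1 i

/-! ### Minimal monomial generating families -/

section Minimal

variable {K R β : Type*} [Field K] [CommRing R] [Algebra K R] {t : ℕ} {F : Fin t → R} {v : β → R}
  (B : Module.Basis ((Fin t → ℕ) × β) K R) {m D : ℕ} {J : Ideal R}

theorem eq_of_le_of_mem_boundedExponents {a b : Fin t → ℕ} (hab : a ≤ b)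
    (ha : a ∈ boundedExponents t m D) (hb : b ∈ boundedExponents t m D) : a = b := by
  have h := (Finset.sum_eq_sum_iff_of_le fun i _ => hab i).mp (ha.2.trans hb.2.symm)
  exact funext fun i => h i (Finset.mem_univ i)

theorem minimallyGenerates_of_bijOn [Nonempty β] (hB : ∀ x, B x = fpow F x.1 * v x.2)
    (hJ : J = Ideal.span (fpow F '' boundedExponents t m D)) {ι : Type*} (g : ι → J)
    (a : ι → Fin t → ℕ) (hg : ∀ i, (g i : R) = fpow F (a i)) (hinj : Function.Injective a)
    (hrange : Set.range a = boundedExponents t m D) : MinimallyGenerates J g := by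
  constructor
  · refine Eq.trans ?_ hJ.symm
    rw [← hrange, ← Set.range_comp]
    congr 2
    exact funext hg
  · intro i hi
    have h : (fun j => (g j : R)) '' {j | j ≠ i} = fpow F '' (a '' {j | j ≠ i}) := by
      rw [Set.image_image]
      exact Set.image_congr fun j _ => hg j
    rw [h, hg, fpow_mem_span_fpow_iff B hB] at hi
    obtain ⟨_, ⟨j, hj, rfl⟩, hle⟩ := hi
    have hmem : ∀ i, a i ∈ boundedExponents t m D := fun i => hrange ▸ Set.mem_range_self i
    exact hj (hinj (eq_of_le_of_mem_boundedExponents hle (hmem j) (hmem i)))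

/-- The exponents of a minimal generating family of monomials in `F`. -/
theorem injective_and_range_eq_of_minimallyGenerates [Nonempty β]
    (hB : ∀ x, B x = fpow F x.1 * v x.2)
    (hJ : J = Ideal.span (fpow F '' boundedExponents t m D)) {ι : Type*} (g : ι → J)
    (a : ι → Fin t → ℕ) (hg : ∀ i, (g i : R) = fpow F (a i)) (hmin : MinimallyGenerates J g) :
    Function.Injective a ∧ Set.range a = boundedExponents t m D := by
  obtain ⟨hgen, hirr⟩ := hmin
  have himg : ∀ s : Set ι, (fun j => (g j : R)) '' s = fpow F '' (a '' s) := by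
    intro s
    rw [Set.image_image]
    exact Set.image_congr fun j _ => hg j
  rw [Generates, ← Set.image_univ, himg, Set.image_univ] at hgen
  have hred : ∀ i j, a j ≤ a i → j = i := by
    intro i j hle
    by_contra hne
    refine hirr i ?_
    rw [himg, hg, fpow_mem_span_fpow_iff B hB]
    exact ⟨_, ⟨j, hne, rfl⟩, hle⟩
  have hup : ∀ i, ∃ u ∈ boundedExponents t m D, u ≤ a i := by
    intro i
    rw [← fpow_mem_span_fpow_iff B hB, ← hJ, ← hg]
    exact (g i).2
  have hdown : ∀ u ∈ boundedExponents t m D, ∃ i, a i ≤ u := by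
    intro u hu
    have h : fpow F u ∈ Ideal.span (fpow F '' Set.range a) := by
      rw [hgen, hJ]
      exact Ideal.subset_span ⟨u, hu, rfl⟩
    rw [fpow_mem_span_fpow_iff B hB] at h
    obtain ⟨_, ⟨i, rfl⟩, hi⟩ := h
    exact ⟨i, hi⟩
  -- Here `u' ≤ a i ≤ u` with `u'` and `u` of the same total, so all three coincide.
  have hsub : ∀ u ∈ boundedExponents t m D, ∃ i, a i = u := by
    intro u hu
    obtain ⟨i, hi⟩ := hdown u hu
    obtain ⟨u', hu', hle⟩ := hup i
    have := eq_of_le_of_mem_boundedExponents (hle.trans hi) hu' hu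
    exact ⟨i, le_antisymm hi (this ▸ hle)⟩
  refine ⟨fun i j hij => hred j i hij.le, Set.Subset.antisymm ?_ hsub⟩
  rintro _ ⟨i, rfl⟩
  obtain ⟨u, hu, hle⟩ := hup i
  obtain ⟨j, rfl⟩ := hsub u hu
  rwa [← hred i j hle]

end Minimal

/-! ### Polymatroidal exchange and rewriting -/

section Exchange

variable {ι : Type*} {t m D : ℕ} {a : ι → Fin t → ℕ}

theorem exists_lt_of_mem_boundedExponents {u v : Fin t → ℕ} (hu : u ∈ boundedExponents t m D)
    (hv : v ∈ boundedExponents t m D) {i : Fin t} (hi : u i < v i) : ∃ j, v j < u j := by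
  by_contra! h
  exact (Finset.sum_lt_sum (fun j _ => h j) ⟨i, Finset.mem_univ i, hi⟩).ne (hu.2.trans hv.2.symm)

/-- One unit moves from `i` to `j`. The additive form avoids truncated subtraction and is exactly
the hypothesis of a linear binomial relation. -/
theorem exists_exchange (hrange : Set.range a = boundedExponents t m D) (k : ι) {i j : Fin t}
    (hij : i ≠ j) (hi : 0 < a k i) (hj : a k j < m) :
    ∃ l, Pi.single i 1 + a l = Pi.single j 1 + a k ∧ a l i + 1 = a k i ∧ a l j = a k j + 1 ∧
      ∀ r, r ≠ i → r ≠ j → a l r = a k r := by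
  classical
  have hk : a k ∈ boundedExponents t m D := hrange ▸ Set.mem_range_self k
  have hle : (Pi.single i 1 : Fin t → ℕ) ≤ Pi.single j 1 + a k := by
    intro r
    by_cases hr : r = i
    · subst hr
      simp only [Pi.single_eq_same, Pi.add_apply]
      omega
    · simp [Pi.single_eq_of_ne hr]
  obtain ⟨b, hb⟩ : ∃ b, (Pi.single i 1 : Fin t → ℕ) + b = Pi.single j 1 + a k :=
    ⟨_, add_tsub_cancel_of_le hle⟩
  have hbi : b i + 1 = a k i := by
    have := congrFun hb i
    simp only [Pi.add_apply, Pi.single_eq_same, Pi.single_eq_of_ne hij] at this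
    omega
  have hbj : b j = a k j + 1 := by
    have := congrFun hb j
    simp only [Pi.add_apply, Pi.single_eq_same, Pi.single_eq_of_ne hij.symm] at this
    omega
  have hbr : ∀ r, r ≠ i → r ≠ j → b r = a k r := by
    intro r hri hrj
    have := congrFun hb r
    simp only [Pi.add_apply, Pi.single_eq_of_ne hri, Pi.single_eq_of_ne hrj] at this
    omega
  have hmem : b ∈ boundedExponents t m D := by
    refine ⟨fun r => ?_, ?_⟩
    · by_cases hri : r = i
      · have := hk.1 i
        subst hri
        omega
      · by_cases hrj : r = j
        · subst hrj
          omega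
        · rw [hbr r hri hrj]
          exact hk.1 r
    · have h1 : ∑ r, ((Pi.single i 1 : Fin t → ℕ) + b) r =
          ∑ r, ((Pi.single j 1 : Fin t → ℕ) + a k) r := by rw [hb]
      simp only [Pi.add_apply, Finset.sum_add_distrib, Finset.sum_pi_single', Finset.mem_univ,
        if_true, hk.2] at h1
      omega
  rw [← hrange] at hmem
  obtain ⟨l, rfl⟩ := hmem
  exact ⟨l, hb, hbi, hbj, hbr⟩

theorem sum_map_apply_le (hrange : Set.range a = boundedExponents t m D) (α : Multiset ι)
    (i : Fin t) : (α.map a).sum i ≤ m * α.card := by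
  induction α using Multiset.induction_on with
  | empty => simp
  | cons k α ih =>
    have hk : a k ∈ boundedExponents t m D := hrange ▸ Set.mem_range_self k
    have := hk.1 i
    rw [Multiset.map_cons, Multiset.sum_cons, Multiset.card_cons, Pi.add_apply, mul_add]
    omega

theorem exists_mem_pos_of_sum_pos (α : Multiset ι) (j : Fin t) (hj : 0 < (α.map a).sum j) :
    ∃ y ∈ α, 0 < a y j := by
  induction α using Multiset.induction_on with
  | empty => simp at hj
  | cons k α ih =>
    rw [Multiset.map_cons, Multiset.sum_cons, Pi.add_apply] at hj
    by_cases hk : 0 < a k j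
    · exact ⟨k, Multiset.mem_cons_self k α, hk⟩
    · obtain ⟨y, hy, h⟩ := ih (by omega)
      exact ⟨y, Multiset.mem_cons_of_mem hy, h⟩

theorem exists_mem_lt_of_sum_lt (α : Multiset ι) (i : Fin t)
    (hi : (α.map a).sum i < m * α.card) : ∃ z ∈ α, a z i < m := by
  induction α using Multiset.induction_on with
  | empty => simp at hi
  | cons k α ih =>
    rw [Multiset.map_cons, Multiset.sum_cons, Pi.add_apply, Multiset.card_cons, mul_add] at hi
    by_cases hk : a k i < m
    · exact ⟨k, Multiset.mem_cons_self k α, hk⟩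
    · obtain ⟨y, hy, h⟩ := ih (by omega)
      exact ⟨y, Multiset.mem_cons_of_mem hy, h⟩

/-- A multiset of exponent vectors can be rearranged, keeping its size and sum, so that one of its
members can be increased at `i` and decreased at `j`. -/
theorem exists_rearrangement (hrange : Set.range a = boundedExponents t m D) (α : Multiset ι)
    {i j : Fin t} (hij : i ≠ j) (hj : 0 < (α.map a).sum j)
    (hi : (α.map a).sum i < m * α.card) :
    ∃ (x : ι) (α' : Multiset ι), α.card = α'.card + 1 ∧
      (α.map a).sum = a x + (α'.map a).sum ∧ 0 < a x j ∧ a x i < m := by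
  classical
  have hmem : ∀ k, a k ∈ boundedExponents t m D := fun k => hrange ▸ Set.mem_range_self k
  obtain ⟨y, hy, hyj⟩ := exists_mem_pos_of_sum_pos α j hj
  obtain ⟨z, hz, hzi⟩ := exists_mem_lt_of_sum_lt α i hi
  by_cases hyi : a y i < m
  · obtain ⟨α', rfl⟩ := Multiset.exists_cons_of_mem hy
    exact ⟨y, α', by simp, by simp, hyj, hyi⟩
  by_cases hzj : 0 < a z j
  · obtain ⟨α', rfl⟩ := Multiset.exists_cons_of_mem hz
    exact ⟨z, α', by simp, by simp, hzj, hzi⟩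
  obtain ⟨α₁, rfl⟩ := Multiset.exists_cons_of_mem hy
  have hzy : z ≠ y := by
    rintro rfl
    exact hyi hzi
  obtain ⟨α₀, rfl⟩ := Multiset.exists_cons_of_mem ((Multiset.mem_cons.mp hz).resolve_left hzy)
  -- Neither member works alone: `a y i = m` and `a z j = 0`. Since `z` exceeds `y` at some `l`,
  -- necessarily different from `i` and `j`, trading a unit of `i` in `y` for a unit of `l` in `z`
  -- keeps the sum and makes `y` suitable.
  obtain ⟨l, hl⟩ := exists_lt_of_mem_boundedExponents (hmem z) (hmem y)
    (hzi.trans_le (not_lt.mp hyi))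
  have hli : l ≠ i := by
    rintro rfl
    omega
  have hlj : l ≠ j := by
    rintro rfl
    omega
  have hzl := (hmem z).1 l
  obtain ⟨y', hy', hy'i, -, hy'r⟩ := exists_exchange hrange y hli.symm (by omega) (by omega)
  obtain ⟨z', hz', -⟩ := exists_exchange hrange z hli (by omega) hzi
  have hadd : a y' + a z' = a y + a z := by
    have h := congrArg₂ (· + ·) hy' hz'
    have h' : (Pi.single i 1 + Pi.single l 1 : Fin t → ℕ) + (a y' + a z') =
        (Pi.single i 1 + Pi.single l 1) + (a y + a z) := by
      rw [add_add_add_comm, add_comm (Pi.single i 1 : Fin t → ℕ) (Pi.single l 1),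
        add_add_add_comm (Pi.single l 1)]
      exact h
    exact add_left_cancel h'
  refine ⟨y', z' ::ₘ α₀, by simp, ?_, ?_, ?_⟩
  · simp only [Multiset.map_cons, Multiset.sum_cons]
    rw [← add_assoc, ← add_assoc, hadd]
  · rw [hy'r j hij.symm hlj.symm]
    exact hyj
  · have := (hmem y).1 i
    omega

theorem sum_tsub_lt_of_exchange_left {u u' v : Fin t → ℕ} {i j : Fin t}
    (hi : u' i + 1 = u i) (hj : u' j = u j + 1) (hr : ∀ r, r ≠ i → r ≠ j → u' r = u r)
    (hvi : v i < u i) (hvj : u j < v j) : ∑ r, (u' r - v r) < ∑ r, (u r - v r) := by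
  refine Finset.sum_lt_sum (fun r _ => ?_) ⟨i, Finset.mem_univ i, by omega⟩
  by_cases hri : r = i
  · subst hri
    omega
  · by_cases hrj : r = j
    · subst hrj
      omega
    · rw [hr r hri hrj]

theorem sum_tsub_lt_of_exchange_right {u v v' : Fin t → ℕ} {i j : Fin t}
    (hj : v' j + 1 = v j) (hi : v' i = v i + 1) (hr : ∀ r, r ≠ j → r ≠ i → v' r = v r)
    (hvi : v i < u i) (hvj : u j < v j) : ∑ r, (u r - v' r) < ∑ r, (u r - v r) := by
  refine Finset.sum_lt_sum (fun r _ => ?_) ⟨i, Finset.mem_univ i, by omega⟩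
  by_cases hri : r = i
  · subst hri
    omega
  · by_cases hrj : r = j
    · subst hrj
      omega
    · rw [hr r hrj hri]

/-- In a commutative ring in which the linear and quadratic exchange relations hold, a product of a
monomial in `f` and a monomial in `X` depends only on its total exponent and its `X`-degree. -/
theorem fpow_mul_prod_eq {A : Type*} [CommRing A] (hinj : Function.Injective a)
    (hrange : Set.range a = boundedExponents t m D) (f : Fin t → A) (X : ι → A)
    (hlin : ∀ i j k l, Pi.single i 1 + a k = Pi.single j 1 + a l → f i * X k = f j * X l)
    (hquad : ∀ i j k l, a i + a j = a k + a l → X i * X j = X k * X l)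
    (s : ℕ) (α β : Multiset ι) (hα : α.card = s) (hβ : β.card = s) (p q : Fin t → ℕ)
    (h : p + (α.map a).sum = q + (β.map a).sum) :
    fpow f p * (α.map X).prod = fpow f q * (β.map X).prod := by
  classical
  have hmem : ∀ k, a k ∈ boundedExponents t m D := fun k => hrange ▸ Set.mem_range_self k
  have hfac : ∀ (p : Fin t → ℕ) (j : Fin t), 0 < p j →
      ∃ p' : Fin t → ℕ, p = Pi.single j 1 + p' := by
    intro p j hp
    refine ⟨_, (add_tsub_cancel_of_le fun r => ?_).symm⟩
    by_cases hr : r = j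
    · subst hr
      rw [Pi.single_eq_same]
      exact hp
    · simp [Pi.single_eq_of_ne hr]
  induction s generalizing α β p q with
  | zero =>
    rw [Multiset.card_eq_zero] at hα hβ
    subst hα hβ
    simp only [Multiset.map_zero, Multiset.sum_zero, add_zero] at h
    rw [h]
  | succ s ih =>
    obtain ⟨x, α, rfl⟩ := Multiset.card_pos_iff_exists_mem.mp (by omega : 0 < α.card) |>.imp
      fun x hx => Multiset.exists_cons_of_mem hx
    obtain ⟨y, β, rfl⟩ := Multiset.card_pos_iff_exists_mem.mp (by omega : 0 < β.card) |>.imp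
      fun x hx => Multiset.exists_cons_of_mem hx
    simp only [Multiset.card_cons, Nat.add_right_cancel_iff] at hα hβ
    simp only [Multiset.map_cons, Multiset.sum_cons, Multiset.prod_cons] at h ⊢
    -- Inside the induction on the `X`-degree, the distance between the leading factors `x` and `y`
    -- is driven down until they agree and can be cancelled. The truncated subtraction counts only
    -- the excess of `x` over `y`.
    generalize hd : ∑ r, (a x r - a y r) = d
    induction d using Nat.strong_induction_on generalizing x y α β p q with
    | _ d ihd =>
    by_cases hxy : x = y
    · subst hxy
      have h' : p + (α.map a).sum = q + (β.map a).sum := by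
        rw [add_left_comm, add_left_comm q] at h
        exact add_left_cancel h
      rw [mul_left_comm, ih α β hα hβ p q h', mul_left_comm]
    obtain ⟨i, hi⟩ : ∃ i, a y i < a x i := by
      by_contra! hle
      exact hxy (hinj (eq_of_le_of_mem_boundedExponents hle (hmem x) (hmem y)))
    obtain ⟨j, hj⟩ := exists_lt_of_mem_boundedExponents (hmem y) (hmem x) hi
    have hij : i ≠ j := by
      rintro rfl
      omega
    have hxi := (hmem x).1 i
    have hyj := (hmem y).1 j
    obtain ⟨x', hx', hx'i, hx'j, hx'r⟩ := exists_exchange hrange x hij (by omega) (by omega)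
    obtain ⟨y', hy', hy'j, hy'i, hy'r⟩ := exists_exchange hrange y hij.symm (by omega) (by omega)
    have hlt := sum_tsub_lt_of_exchange_left hx'i hx'j hx'r hi hj
    have hlt' := sum_tsub_lt_of_exchange_right hy'j hy'i hy'r hi hj
    -- If `f j` divides the left coefficient, a linear relation replaces `x` by `x'`, which is
    -- closer to `y`.
    by_cases hpj : 0 < p j
    · obtain ⟨p', rfl⟩ := hfac p j hpj
      have h1 : Pi.single i 1 + p' + (a x' + (α.map a).sum) = q + (a y + (β.map a).sum) := by
        linear_combination h + hx'
      have h2 := ihd _ (hd ▸ hlt) (Pi.single i 1 + p') q x' α y β hα hβ h1 rfl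
      rw [← h2, fpow_add, fpow_add, fpow_single, fpow_single]
      have := hlin _ _ _ _ hx'
      linear_combination (-(fpow f p' * (α.map X).prod)) * this
    -- Symmetrically, a factor `f i` on the right lets a linear relation replace `y` by `y'`.
    by_cases hqi : 0 < q i
    · obtain ⟨q', rfl⟩ := hfac q i hqi
      have h1 : p + (a x + (α.map a).sum) =
          Pi.single j 1 + q' + (a y' + (β.map a).sum) := by
        linear_combination h - hy'
      have h2 := ihd _ (hd ▸ hlt') p (Pi.single j 1 + q') x α y' β hα hβ h1 rfl
      rw [h2, fpow_add, fpow_add, fpow_single, fpow_single]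
      have := hlin _ _ _ _ hy'
      linear_combination (fpow f q' * (β.map X).prod) * this
    -- Now `p j = 0` and `q i = 0`. Comparing coordinates `j` and `i` shows that the sum over `α` is
    -- positive at `j` and below `m * s` at `i`. So, after a rearrangement allowed by the induction
    -- on `s`, some factor `z` can give up a unit of `j` for one of `i`, and a quadratic relation
    -- turns `x, z` into `x', z'`.
    have hsj := congrFun h j
    have hsi := congrFun h i
    simp only [Pi.add_apply] at hsj hsi
    have hβi := sum_map_apply_le hrange β i
    rw [hβ, ← hα] at hβi
    obtain ⟨z, α', hcard, hsum, hzj, hzi⟩ := exists_rearrangement hrange α hij (by omega) (by omega)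
    obtain ⟨z', hz', -⟩ := exists_exchange hrange z hij.symm hzj hzi
    have hxz : a x + a z = a x' + a z' := by
      refine add_left_cancel (a := (Pi.single i 1 + Pi.single j 1 : Fin t → ℕ)) ?_
      linear_combination -hx' - hz'
    have h1 : p + (a x' + ((z' ::ₘ α').map a).sum) = q + (a y + (β.map a).sum) := by
      rw [Multiset.map_cons, Multiset.sum_cons]
      linear_combination h - hsum - hxz
    have h2 := ihd _ (hd ▸ hlt) p q x' (z' ::ₘ α') y β (by rw [Multiset.card_cons]; omega) hβ h1 rfl
    have h3 := ih α (z ::ₘ α') hα (by rw [Multiset.card_cons]; omega) 0 0 (by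
      rw [hsum, Multiset.map_cons, Multiset.sum_cons])
    simp only [fpow_zero, one_mul, Multiset.map_cons, Multiset.prod_cons] at h2 h3
    have h4 := hquad _ _ _ _ hxz
    rw [← h2, h3]
    linear_combination (fpow f p * (α'.map X).prod) * h4

end Exchange

/-! ### Binomial generators of the kernel -/

/-- The kernel of a linear map sending basis vectors to basis vectors is spanned by differences of
basis vectors. -/
theorem mem_span_sub_of_map_basis {K M N X Y : Type*} [Field K] [AddCommGroup M] [AddCommGroup N]
    [Module K M] [Module K N] (b : Module.Basis X K M) (b' : Module.Basis Y K N) (f : M →ₗ[K] N)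
    (h : X → Y) (hf : ∀ x, f (b x) = b' (h x)) {z : M} (hz : f z = 0) :
    z ∈ Submodule.span K {z | ∃ x y, h x = h y ∧ z = b x - b y} := by
  classical
  rcases isEmpty_or_nonempty X with hX | hX
  · rw [← b.linearCombination_repr z, Subsingleton.elim (b.repr z) 0]
    simp
  -- A section picks one representative per fiber of `h`; `id - g ∘ f` fixes the kernel of `f` and
  -- sends each basis vector to its difference from its representative.
  let g : N →ₗ[K] M := b'.constr K fun y => b (Function.invFun h y)
  have key : ∀ z, z - g (f z) ∈ Submodule.span K {z | ∃ x y, h x = h y ∧ z = b x - b y} := by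
    intro z
    have : (⊤ : Submodule K M) ≤ (Submodule.span K {z | ∃ x y, h x = h y ∧ z = b x - b y}).comap
        (LinearMap.id - g ∘ₗ f) := by
      rw [← b.span_eq, Submodule.span_le]
      rintro _ ⟨x, rfl⟩
      refine Submodule.subset_span ⟨x, Function.invFun h (h x),
        (Function.invFun_eq ⟨x, rfl⟩).symm, ?_⟩
      simp [g, hf, Module.Basis.constr_basis]
    exact this trivial
  simpa [hz] using key z

section Kernel

open MvPolynomial

/-- The linear syzygy binomials of a family of monomials with exponents `a`. -/
def linearBinomials {R : Type*} [CommRing R] {t : ℕ} (F : Fin t → R) {ι : Type*}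
    (a : ι → Fin t → ℕ) : Set (MvPolynomial ι R) :=
  {p | ∃ i j k l, Pi.single i 1 + a k = Pi.single j 1 + a l ∧
    p = C (F i) * X k - C (F j) * X l}

/-- The quadratic exchange binomials of a family of exponents `a`. -/
def exponentBinomials (R : Type*) [CommRing R] {t : ℕ} {ι : Type*}
    (a : ι → Fin t → ℕ) : Set (MvPolynomial ι R) :=
  {p | ∃ i j k l, a i + a j = a k + a l ∧ p = X i * X j - X k * X l}

theorem prod_map_toMultiset {A ι : Type*} [CommMonoid A] (g : ι → A) (α : ι →₀ ℕ) :
    ((Finsupp.toMultiset α).map g).prod = α.prod fun i k => g i ^ k := by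
  induction α using Finsupp.induction_linear with
  | zero => simp
  | add α β hα hβ =>
    rw [map_add, Multiset.map_add, Multiset.prod_add, hα, hβ,
      Finsupp.prod_add_index' (by simp) (by intros; rw [pow_add])]
  | single i k => simp [Multiset.map_nsmul, Multiset.prod_nsmul]

theorem monomial_one_eq_prod_toMultiset {R ι : Type*} [CommRing R] (α : ι →₀ ℕ) :
    monomial α (1 : R) = ((Finsupp.toMultiset α).map X).prod := by
  rw [prod_map_toMultiset, MvPolynomial.monomial_eq, C_1, one_mul]

theorem prod_map_monomial_fpow {R ι : Type*} [CommRing R] {t : ℕ} (F : Fin t → R)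
    (a : ι → Fin t → ℕ) (α : Multiset ι) :
    (α.map fun i => Polynomial.monomial 1 (fpow F (a i))).prod =
      Polynomial.monomial α.card (fpow F (α.map a).sum) := by
  induction α using Multiset.induction_on with
  | empty => simp
  | cons k α ih =>
    simp only [Multiset.map_cons, Multiset.prod_cons, ih, Multiset.card_cons, Multiset.sum_cons,
      Polynomial.monomial_mul_monomial, fpow_add]
    rw [add_comm]

/-- The basis vector `F^u v_b T^α` maps to the basis vector of `R[t]` with exponent `u` plus the sum
of `a` over `α`, the same `b`, and `t`-degree `|α|`. Equality of these data is what
`fpow_mul_prod_eq` needs in the quotient by the binomials. -/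
theorem mem_span_binomials_of_aeval_eq_zero {K R β : Type*} [Field K] [CommRing R] [Algebra K R]
    {t : ℕ} {F : Fin t → R} {v : β → R} (B : Module.Basis ((Fin t → ℕ) × β) K R)
    (hB : ∀ x, B x = fpow F x.1 * v x.2) {m D : ℕ} {ι : Type*} {a : ι → Fin t → ℕ}
    (hinj : Function.Injective a) (hrange : Set.range a = boundedExponents t m D)
    {p : MvPolynomial ι R}
    (hp : aeval (fun i => Polynomial.monomial 1 (fpow F (a i))) p = 0) :
    p ∈ Ideal.span (linearBinomials F a ∪ exponentBinomials R a) := by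
  set L := Ideal.span (linearBinomials F a ∪ exponentBinomials R a) with hL
  let φ : MvPolynomial ι R →ₐ[R] Polynomial R :=
    aeval fun i => Polynomial.monomial 1 (fpow F (a i))
  have h1 := mem_span_sub_of_map_basis (B.smulTower (basisMonomials ι R))
    (B.smulTower (Polynomial.basisMonomials R)) (φ.restrictScalars K).toLinearMap
    (fun x => ((x.1.1 + ((Finsupp.toMultiset x.2).map a).sum, x.1.2),
      (Finsupp.toMultiset x.2).card)) (by
      rintro ⟨⟨u, b⟩, α⟩
      simp only [Module.Basis.smulTower_apply, coe_basisMonomials, Polynomial.coe_basisMonomials,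
        AlgHom.toLinearMap_apply, AlgHom.coe_restrictScalars', map_smul, hB, φ, aeval_monomial,
        ← prod_map_toMultiset, prod_map_monomial_fpow, map_one, one_mul, fpow_add,
        Polynomial.smul_monomial, smul_eq_mul, mul_one]
      congr 1
      ring) hp
  refine (Submodule.span_le (p := L.restrictScalars K)).mpr ?_ h1
  rintro _ ⟨⟨⟨u, b⟩, α⟩, ⟨⟨u', b'⟩, α'⟩, h, rfl⟩
  simp only [Prod.mk.injEq] at h
  obtain ⟨⟨hu, rfl⟩, hcard⟩ := h
  have hgen := fpow_mul_prod_eq hinj hrange (fun i => Ideal.Quotient.mk L (C (F i)))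
    (fun i => Ideal.Quotient.mk L (X i)) (fun i j k l h => by
      rw [← map_mul, ← map_mul, Ideal.Quotient.eq]
      exact Ideal.subset_span (Or.inl ⟨i, j, k, l, h, rfl⟩)) (fun i j k l h => by
      rw [← map_mul, ← map_mul, Ideal.Quotient.eq]
      exact Ideal.subset_span (Or.inr ⟨i, j, k, l, h, rfl⟩)) _ _ _ hcard rfl u u' hu
  have hfp : ∀ u, fpow (fun i => Ideal.Quotient.mk L (C (F i))) u =
      Ideal.Quotient.mk L (C (fpow F u)) := by
    intro u
    simp [fpow]
  have hpr : ∀ α : Multiset ι, (α.map fun i => Ideal.Quotient.mk L (X i)).prod =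
      Ideal.Quotient.mk L (α.map X).prod := by
    intro α
    rw [map_multiset_prod, Multiset.map_map]
    rfl
  rw [hfp, hfp, hpr, hpr, ← map_mul, ← map_mul, Ideal.Quotient.eq] at hgen
  have := L.mul_mem_left (C (v b)) hgen
  change _ ∈ L
  convert this using 1
  simp only [Module.Basis.smulTower_apply, coe_basisMonomials, hB, monomial_one_eq_prod_toMultiset,
    MvPolynomial.smul_eq_C_mul, map_mul]
  ring

end Kernel

/-! ### Rees equations and change of generators -/

section Rees

open MvPolynomial

variable {R : Type*} [CommRing R] (J : Ideal R)

theorem val_reesPresentation {ι : Type*} (g : ι → J) (p : MvPolynomial ι R) :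
    (reesPresentation J g p : Polynomial R) =
      aeval (fun i => Polynomial.monomial 1 (g i : R)) p := by
  have h : (reesAlgebra J).val.comp (reesPresentation J g) =
      aeval (fun i => Polynomial.monomial 1 (g i : R)) := by
    ext i
    simp [reesPresentation, reesElement]
  exact DFunLike.congr_fun h p

theorem mem_reesDefiningIdeal_iff {ι : Type*} (g : ι → J) (p : MvPolynomial ι R) :
    p ∈ reesDefiningIdeal J g ↔ aeval (fun i => Polynomial.monomial 1 (g i : R)) p = 0 := by
  rw [reesDefiningIdeal, RingHom.mem_ker, ← val_reesPresentation, ZeroMemClass.coe_eq_zero]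

theorem reesElement_eq_sum {ι : Type*} [Fintype ι] (g : ι → J) (x : J) (c : ι → R)
    (h : ∑ i, c i * (g i : R) = x) : reesElement J x = ∑ i, c i • reesElement J (g i) := by
  refine Subtype.ext ?_
  rw [AddSubmonoidClass.coe_finsetSum]
  simp only [reesElement, ← h, map_sum, SetLike.val_smul, Polynomial.smul_monomial, smul_eq_mul]

/-- The Rees algebra is generated over `R` by its degree-one part, which the `g i t` span. -/
theorem reesPresentation_surjective {ι : Type*} [Fintype ι] {g : ι → J} (hg : Generates J g) :
    Function.Surjective (reesPresentation J g) := by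
  have h : (⊤ : Subalgebra R (reesAlgebra J)) ≤ (reesPresentation J g).range := by
    have h1 : reesAlgebra J ≤ (reesPresentation J g).range.map (reesAlgebra J).val := by
      refine (adjoin_monomial_eq_reesAlgebra J).ge.trans (Algebra.adjoin_le ?_)
      rintro _ ⟨x, hx, rfl⟩
      have hx' : x ∈ Ideal.span (Set.range fun i => (g i : R)) := by
        rw [hg]
        exact hx
      obtain ⟨c, hc⟩ := Ideal.mem_span_range_iff_exists_fun.mp hx'
      refine ⟨reesElement J ⟨x, hx⟩, ⟨∑ i, c i • X i, ?_⟩, rfl⟩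
      rw [reesElement_eq_sum J g ⟨x, hx⟩ c hc]
      simp [reesPresentation]
    intro z _
    obtain ⟨y, hy, hyz⟩ := h1 z.2
    rwa [← Subtype.ext (a1 := y) (a2 := z) hyz]
  intro z
  exact h trivial

theorem isHomogeneous_sum_smul_X {σ τ : Type*} [Fintype τ] (c : σ → τ → R) (i : σ) :
    (∑ j, c i j • X j : MvPolynomial τ R).IsHomogeneous 1 := by
  refine IsHomogeneous.sum _ _ _ fun j _ => ?_
  rw [smul_eq_C_mul]
  simpa using (isHomogeneous_C τ (c i j)).mul (isHomogeneous_X R j)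

/-- The degrees needed to generate the defining ideal of a Rees algebra do not depend on the chosen
generators. -/
theorem generatedInDegreeLE_of_generates {ι κ : Type*} [Fintype ι] [Fintype κ] {g : ι → J}
    {g' : κ → J} (hg : Generates J g) (hg' : Generates J g') {N : ℕ} (hN : 1 ≤ N)
    (h : GeneratedInDegreeLE (reesDefiningIdeal J g') N) :
    GeneratedInDegreeLE (reesDefiningIdeal J g) N := by
  have hA : ∀ i, ∃ c : κ → R, ∑ j, c j * (g' j : R) = g i := fun i => by
    rw [← Ideal.mem_span_range_iff_exists_fun, hg']
    exact (g i).2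
  have hB : ∀ j, ∃ c : ι → R, ∑ i, c i * (g i : R) = g' j := fun j => by
    rw [← Ideal.mem_span_range_iff_exists_fun, hg]
    exact (g' j).2
  choose A hA using hA
  choose B hB using hB
  let φ : MvPolynomial ι R →ₐ[R] MvPolynomial κ R := aeval fun i => ∑ j, A i j • X j
  let ψ : MvPolynomial κ R →ₐ[R] MvPolynomial ι R := aeval fun j => ∑ i, B j i • X i
  have hφ : (reesPresentation J g').comp φ = reesPresentation J g := by
    ext i : 1
    simp [φ, reesPresentation, ← reesElement_eq_sum J g' (g i) _ (hA i)]
  have hψ : (reesPresentation J g).comp ψ = reesPresentation J g' := by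
    ext j : 1
    simp [ψ, reesPresentation, ← reesElement_eq_sum J g (g' j) _ (hB j)]
  have hφ' : ∀ p, reesPresentation J g' (φ p) = reesPresentation J g p :=
    fun p => DFunLike.congr_fun hφ p
  have hψ' : ∀ p, reesPresentation J g (ψ p) = reesPresentation J g' p :=
    fun p => DFunLike.congr_fun hψ p
  set S : Set (MvPolynomial ι R) :=
    {p | p ∈ reesDefiningIdeal J g ∧ ∃ s ≤ N, p.IsHomogeneous s} with hS
  refine le_antisymm (Ideal.span_le.mpr fun p hp => hp.1) fun p hp => ?_
  -- The substitution `ψ` uses linear forms, so it carries the low-degree equations of `g'` to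
  -- equations of `g` of the same degrees.
  have h1 : ψ (φ p) ∈ Ideal.span S := by
    have h2 : φ p ∈ reesDefiningIdeal J g' := by
      rw [reesDefiningIdeal, RingHom.mem_ker, hφ']
      exact hp
    rw [← h] at h2
    have h3 := Ideal.mem_map_of_mem ψ h2
    rw [Ideal.map_span] at h3
    refine Ideal.span_mono ?_ h3
    rintro _ ⟨q, ⟨hq, s, hs, hqs⟩, rfl⟩
    refine ⟨?_, s, hs, ?_⟩
    · rw [reesDefiningIdeal, RingHom.mem_ker, hψ']
      exact hq
    · have := hqs.aeval (fun j => ∑ i, B j i • X i) (fun j => isHomogeneous_sum_smul_X B j)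
      rwa [one_mul] at this
  -- Modulo `S` the composite `ψ ∘ φ` is the identity, since each `X i - ψ (φ (X i))` is a linear
  -- equation of `g`; this is where `1 ≤ N` enters.
  have h2 : p - ψ (φ p) ∈ Ideal.span S := by
    have h3 : Ideal.Quotient.mkₐ R (Ideal.span S) =
        (Ideal.Quotient.mkₐ R (Ideal.span S)).comp (ψ.comp φ) := by
      ext i : 1
      refine Ideal.Quotient.eq.mpr (Ideal.subset_span ⟨?_, 1, hN, ?_⟩)
      · rw [reesDefiningIdeal, RingHom.mem_ker, map_sub, sub_eq_zero]
        change _ = reesPresentation J g (ψ (φ (X i)))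
        rw [hψ', hφ']
      · refine (isHomogeneous_X R i).sub ?_
        have h4 : (φ (X i)).IsHomogeneous 1 := by
          simp only [φ, aeval_X]
          exact isHomogeneous_sum_smul_X A i
        have := h4.aeval (fun j => ∑ i, B j i • X i) (fun j => isHomogeneous_sum_smul_X B j)
        rwa [one_mul] at this
    exact Ideal.Quotient.eq.mp (DFunLike.congr_fun h3 p)
  have := add_mem h2 h1
  rwa [sub_add_cancel] at this

variable {J}

theorem generatedInDegreeLE_two_of_boundedExponents {K β : Type*} [Field K] [Algebra K R]
    {t : ℕ} {F : Fin t → R} {v : β → R} (B : Module.Basis ((Fin t → ℕ) × β) K R)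
    (hB : ∀ x, B x = fpow F x.1 * v x.2) {m D : ℕ} {ι : Type*} {a : ι → Fin t → ℕ}
    (hinj : Function.Injective a) (hrange : Set.range a = boundedExponents t m D) (g : ι → J)
    (hg : ∀ i, (g i : R) = fpow F (a i)) : GeneratedInDegreeLE (reesDefiningIdeal J g) 2 := by
  refine le_antisymm (Ideal.span_le.mpr fun p hp => hp.1) fun p hp => ?_
  rw [mem_reesDefiningIdeal_iff, funext fun i => congrArg _ (hg i)] at hp
  refine Ideal.span_mono ?_ (mem_span_binomials_of_aeval_eq_zero B hB hinj hrange hp)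
  have hX : ∀ (i : ι), (X i : MvPolynomial ι R).IsHomogeneous 1 := isHomogeneous_X R
  have hCX : ∀ (r : R) (i : ι), (C r * X i : MvPolynomial ι R).IsHomogeneous 1 := fun r i => by
    simpa using (isHomogeneous_C ι r).mul (hX i)
  rintro _ (⟨i, j, k, l, h, rfl⟩ | ⟨i, j, k, l, h, rfl⟩)
  · refine ⟨?_, 1, one_le_two, (hCX _ _).sub (hCX _ _)⟩
    have h' := congrArg (fpow F) h
    simp only [fpow_add, fpow_single] at h'
    rw [mem_reesDefiningIdeal_iff]
    simp [hg, Polynomial.C_mul_monomial, h']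
  · refine ⟨?_, 2, le_rfl, ((hX i).mul (hX j)).sub ((hX k).mul (hX l))⟩
    have h' := congrArg (fpow F) h
    simp only [fpow_add] at h'
    rw [mem_reesDefiningIdeal_iff]
    simp [hg, Polynomial.monomial_mul_monomial, h']

end Rees

/-! ### Fiber cone equations -/

section Fiber

open MvPolynomial

variable {K : Type*} [Field K] {n : ℕ} (J : Ideal (MvPolynomial (Fin n) K))

theorem irrelevantIdeal_le_ker : irrelevantIdeal K n ≤ RingHom.ker (constantCoeff (R := K)) := by
  rw [irrelevantIdeal, Ideal.span_le]
  rintro _ ⟨i, rfl⟩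
  simp

theorem constantCoeff_eq_zero_of_isWeightedHomogeneous {w : Fin n → ℕ}
    {f : MvPolynomial (Fin n) K} {d : ℕ} (hf : f.IsWeightedHomogeneous w d) (hd : 0 < d) :
    constantCoeff f = 0 :=
  hf.coeff_eq_zero 0 (by simpa using hd.ne)

theorem fiberPresentation_apply {ι : Type*} (g : ι → J) (p : MvPolynomial ι K) :
    fiberPresentation J g p = reesPresentation J g (map C p) ⊗ₜ 1 := by
  induction p using MvPolynomial.induction_on with
  | C r =>
    rw [MvPolynomial.map_C, fiberPresentation, reesPresentation, aeval_C, aeval_C]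
    rfl
  | add p q hp hq => rw [map_add, map_add, map_add, hp, hq, TensorProduct.add_tmul]
  | mul_X p i hp =>
    rw [map_mul, map_mul, map_mul, hp, MvPolynomial.map_X]
    simp [fiberPresentation, reesPresentation, Algebra.TensorProduct.tmul_mul_tmul]

theorem tmul_one_eq_zero_iff {R M : Type*} [CommRing R] [AddCommGroup M] [Module R M]
    (I : Ideal R) (x : M) :
    x ⊗ₜ[R] (1 : R ⧸ I) = 0 ↔ x ∈ (I • ⊤ : Submodule R M) := by
  rw [← TensorProduct.tensorQuotEquivQuotSMul_symm_mk, LinearEquiv.map_eq_zero_iff,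
    Submodule.Quotient.mk_eq_zero]

/-- The equations of the fiber cone are the Rees equations with coefficients reduced modulo the
irrelevant ideal. -/
theorem fiberDefiningIdeal_le_map {ι : Type*} [Fintype ι] {g : ι → J} (hg : Generates J g) :
    fiberDefiningIdeal J g ≤ (reesDefiningIdeal J g).map (map (constantCoeff (R := K))) := by
  intro p hp
  rw [fiberDefiningIdeal, RingHom.mem_ker, fiberPresentation_apply, tmul_one_eq_zero_iff] at hp
  -- The image of `p` lies in `(x_1, …, x_n)` times the Rees algebra, so by surjectivity it is also
  -- the image of some `q` with coefficients in that ideal. Then `p - q` is a Rees equation reducing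
  -- to `p`.
  have htop : (⊤ : Submodule (MvPolynomial (Fin n) K) (reesAlgebra J)) =
      (⊤ : Submodule (MvPolynomial (Fin n) K) (MvPolynomial ι (MvPolynomial (Fin n) K))).map
        (reesPresentation J g).toLinearMap := by
    rw [Submodule.map_top, eq_comm, LinearMap.range_eq_top]
    exact reesPresentation_surjective J hg
  rw [htop, ← Submodule.map_smul''] at hp
  obtain ⟨q, hq, hqp⟩ := hp
  have h1 : map C p - q ∈ reesDefiningIdeal J g := by
    rw [reesDefiningIdeal, RingHom.mem_ker, map_sub, sub_eq_zero]
    exact hqp.symm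
  have h2 : map (constantCoeff (R := K)) q = 0 := by
    refine Submodule.smul_induction_on hq ?_ ?_
    · intro r hr z _
      rw [smul_eq_C_mul, map_mul, map_C, RingHom.mem_ker.mp (irrelevantIdeal_le_ker hr), C_0,
        zero_mul]
    · intro x y hx hy
      rw [map_add, hx, hy, add_zero]
  have h3 := Ideal.mem_map_of_mem (map (constantCoeff (R := K))) h1
  rw [map_sub, h2, sub_zero, map_map] at h3
  have h4 : (constantCoeff (R := K)).comp (C : K →+* MvPolynomial (Fin n) K) = RingHom.id K := by
    ext
    simp
  rwa [h4, map_id] at h3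

theorem fiberDefiningIdeal_eq_span {β : Type*} {t : ℕ} {F : Fin t → MvPolynomial (Fin n) K}
    {v : β → MvPolynomial (Fin n) K}
    (B : Module.Basis ((Fin t → ℕ) × β) K (MvPolynomial (Fin n) K))
    (hB : ∀ x, B x = fpow F x.1 * v x.2) (hF : ∀ i, constantCoeff (F i) = 0) {m D : ℕ}
    {ι : Type*} [Fintype ι] {a : ι → Fin t → ℕ}
    (hinj : Function.Injective a) (hrange : Set.range a = boundedExponents t m D) (g : ι → J)
    (hg : ∀ i, (g i : MvPolynomial (Fin n) K) = fpow F (a i)) (hgen : Generates J g) :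
    fiberDefiningIdeal J g = Ideal.span (quadraticBinomials K g) := by
  refine le_antisymm ((fiberDefiningIdeal_le_map J hgen).trans ?_) (Ideal.span_le.mpr ?_)
  · rw [Ideal.map_le_iff_le_comap]
    intro p hp
    rw [mem_reesDefiningIdeal_iff, funext fun i => congrArg _ (hg i)] at hp
    have hle : Ideal.span (linearBinomials F a ∪ exponentBinomials _ a) ≤
        (Ideal.span (quadraticBinomials K g)).comap (map (constantCoeff (R := K))) := by
      rw [Ideal.span_le]
      rintro _ (⟨i, j, k, l, h, rfl⟩ | ⟨i, j, k, l, h, rfl⟩)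
      -- The linear binomials vanish because their coefficients `F i` and `F j` have zero constant
      -- term.
      · simp [hF]
      · refine Ideal.subset_span ⟨i, j, k, l, ?_, by simp⟩
        rw [hg, hg, hg, hg, ← fpow_add, ← fpow_add, h]
    exact hle (mem_span_binomials_of_aeval_eq_zero B hB hinj hrange hp)
  · rintro _ ⟨i, j, k, l, h, rfl⟩
    have h1 : reesElement J (g i) * reesElement J (g j) =
        reesElement J (g k) * reesElement J (g l) := by
      refine Subtype.ext ?_
      simp [reesElement, Polynomial.monomial_mul_monomial, h]
    change fiberPresentation J g _ = 0
    rw [fiberPresentation_apply]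
    simp [reesPresentation, h1]

end Fiber

end StarRees

/-! ### The main theorem -/

theorem theorem3 {K : Type*} [Field K] {n t : ℕ}
    -- positive weights of the variables (all equal to 1: the standard grading)
    (w : Fin n → ℕ) (hw : ∀ i, 0 < w i)
    -- a homogeneous regular sequence
    (F : Fin t → MvPolynomial (Fin n) K) (d : Fin t → ℕ)
    (hF : ∀ i, MvPolynomial.IsWeightedHomogeneous w (F i) (d i))
    (hreg : RingTheory.Sequence.IsRegular (MvPolynomial (Fin n) K) (List.ofFn F))
    (c : ℕ) (hc1 : 1 ≤ c) (hc : c ≤ min n t)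
    -- the ideal is generated in a single degree for some positive grading
    (𝒜 : ℕ → Submodule K (MvPolynomial (Fin n) K)) [GradedAlgebra 𝒜] (h𝒜 : 𝒜 0 = 1)
    (e : ℕ) (hI : ∃ G : Set (MvPolynomial (Fin n) K),
      G ⊆ (𝒜 e : Set (MvPolynomial (Fin n) K)) ∧ Ideal.span G = StarRees.starIdeal c F)
    (m : ℕ) (hm : 1 ≤ m) :
    (∀ (μ : ℕ) (g : Fin μ → ↥(StarRees.starIdeal c F ^ m)),
      StarRees.Generates (StarRees.starIdeal c F ^ m) g →
        StarRees.GeneratedInDegreeLE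
          (StarRees.reesDefiningIdeal (StarRees.starIdeal c F ^ m) g) 2) ∧
    (∃ (μ : ℕ) (g : Fin μ → ↥(StarRees.starIdeal c F ^ m)),
      StarRees.MinimallyGenerates (StarRees.starIdeal c F ^ m) g ∧
        ∀ i, StarRees.IsMonomialIn F (g i : MvPolynomial (Fin n) K)) ∧
    (∀ (μ : ℕ) (g : Fin μ → ↥(StarRees.starIdeal c F ^ m)),
      StarRees.MinimallyGenerates (StarRees.starIdeal c F ^ m) g →
      (∀ i, StarRees.IsMonomialIn F (g i : MvPolynomial (Fin n) K)) →
        StarRees.fiberDefiningIdeal (StarRees.starIdeal c F ^ m) g =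
          Ideal.span (StarRees.quadraticBinomials K g)) := by
  have hct : c ≤ t := hc.trans (min_le_right n t)
  have hd := StarRees.degree_pos_of_isRegular hw F d hF hreg
  obtain ⟨β, v, B, hB⟩ := StarRees.exists_basis_fpow_mul F d hF hd hreg.toIsWeaklyRegular
  have : Nonempty β := B.index_nonempty.map Prod.snd
  have hF0 := fun i => StarRees.constantCoeff_eq_zero_of_isWeightedHomogeneous (hF i) (hd i)
  have hJ := StarRees.starIdeal_pow_eq_span B hB hct m
  have hfin := StarRees.finite_boundedExponents t m (m * (t - c + 1))
  have := hfin.to_subtype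
  -- Enumerating the admissible exponents yields a reference family `g₀`: it is the minimal monomial
  -- family of the second claim, and the first claim is transferred from it.
  let σ := Finite.equivFin (StarRees.boundedExponents t m (m * (t - c + 1)))
  let a₀ := fun i => (σ.symm i : Fin t → ℕ)
  have ha₀ : Function.Injective a₀ := Subtype.val_injective.comp σ.symm.injective
  have hra₀ : Set.range a₀ = StarRees.boundedExponents t m (m * (t - c + 1)) := by
    rw [Set.range_comp' Subtype.val, σ.symm.surjective.range_eq, Set.image_univ,
      Subtype.range_coe]
  let g₀ := fun i => (⟨StarRees.fpow F (a₀ i), by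
    rw [hJ]
    exact Ideal.subset_span ⟨_, (σ.symm i).2, rfl⟩⟩ : ↥(StarRees.starIdeal c F ^ m))
  have hmin₀ := StarRees.minimallyGenerates_of_bijOn B hB hJ g₀ a₀ (fun _ => rfl) ha₀ hra₀
  refine ⟨fun μ g hg => ?_, ⟨_, g₀, hmin₀, fun i => ⟨a₀ i, rfl⟩⟩, fun μ g hmin hmon => ?_⟩
  · exact StarRees.generatedInDegreeLE_of_generates _ hg hmin₀.1 one_le_two
      (StarRees.generatedInDegreeLE_two_of_boundedExponents B hB ha₀ hra₀ g₀ fun _ => rfl)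
  · choose a ha using hmon
    obtain ⟨hinj, hrange⟩ :=
      StarRees.injective_and_range_eq_of_minimallyGenerates B hB hJ g a ha hmin
    exact StarRees.fiberDefiningIdeal_eq_span _ B hB hF0 hinj hrange g ha hmin.1
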